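/- A Büchi game $\mathcal G=(V,V_0,V_1,E,F)$ consists of a finite set $V$ of positions, partitioned into the positions $V_0$ of Player 0 and $V_1$ of Player 1, a relation $E\subseteq V\times V$ of moves such that every position has at least one successor, and a target set $F\subseteq V$. A strategy (of Player 0) from $v$ is a subtree $\mathcal S$, containing the root $v$, of the tree of all finite paths from $v$ in $\mathcal G$ that is closed under (nonempty) prefixes and such that a node of $\mathcal S$ ending in a position of $V_0$ has exactly one successor in $\mathcal S$, while for a node $\rho w$ of $\mathcal S$ with $w\in V_1$ all paths $\rho w w'$ with $ww'\in E$ belong to $\mathcal S$. A play contained in $\mathcal S$ is an infinite path from $v$ all of whose nonempty finite prefixes belong to $\mathcal S$; $\mathcal S$ is winning if every play contained in $\mathcal S$ visits $F$ infinitely often. For an edge $e=ab\in E$ let $\#_e(\mathcal S)\in\mathbb N\cup\{\infty\}$ be the number of nodes of $\mathcal S$ of the form $\rho a$ such that $\rho ab$ is a node of $\mathcal S$ as well. A strategy $\mathcal S$ from $v$ is - *absorption-dominant* if there is no strategy $\mathcal S'$ from $v$ such that $\#_e(\mathcal S')\le\#_e(\mathcal S)$ for all $e\in E$ and $\#_e(\mathcal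 S')<\#_e(\mathcal S)$ for some $e\in E$; - *positional* if at each position $w\in V_0$ it makes the same choice at all occurrences of $w$ in $\mathcal S$, i.e. if $\rho w a,\rho' w b\in\mathcal S$ with $w\in V_0$ implies $a=b$; - *persistent* if within each single play it always makes the same choice at a given position of Player 0, i.e. if for every play $v_0v_1v_2\dots$ contained in $\mathcal S$ and all $i,j$ with $v_i=v_j\in V_0$ one has $v_{i+1}=v_{j+1}$. **Corollary.** In every Büchi game and for every position $v$, every absorption-dominant winning strategy from $v$ is persistent, and every positional winning strategy from $v$ is absorption-dominant. Both inclusions positional $\subsetneq$ absorption-dominant $\subsetneq$ persistent between these classes of winning strategies are strict: there are a Büchi game and an absorption-dominant winning strategy in it that is not positional, and there are a Büchi game and a persistent winning strategy in it that is not absorption-dominant. -/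

import Mathlib

/-- A Büchi game on the positions `V`: `V0` are the positions of Player 0, all other positions
belong to Player 1, `E` is the move relation, `F` the target set; every position has a successor. -/
structure BuchiGame (V : Type*) where
  V0 : Set V
  E : V → V → Prop
  F : Set V
  exists_move : ∀ v, ∃ w, E v w

namespace BuchiGame

variable {V : Type*}

/-- The positions of Player 1. -/
def V1 (G : BuchiGame V) : Set V := G.V0ᶜ

/-- The finite paths from `v₀`, i.e. the nodes of the tree unraveling of `G` from `v₀`.
A finite path is stored with its last position at the head of the list, so that `v :: ρ` is
the path `ρ` prolonged by the position `v`, and `[v₀]` is the root of the unraveling. -/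
inductive IsPath (G : BuchiGame V) (v₀ : V) : List V → Prop
  | root : IsPath G v₀ [v₀]
  | step {u w : V} {ρ : List V} : IsPath G v₀ (u :: ρ) → G.E u w → IsPath G v₀ (w :: u :: ρ)

/-- A strategy of Player 0 from `v₀`: a subtree, containing the root, of the tree unraveling. -/
@[ext]
structure Strategy (G : BuchiGame V) (v₀ : V) where
  nodes : Set (List V)
  isPath : ∀ p ∈ nodes, G.IsPath v₀ p
  root_mem : [v₀] ∈ nodes
  prefix_closed : ∀ (w v : V) (ρ : List V), w :: v :: ρ ∈ nodes → v :: ρ ∈ nodes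
  unique_choice : ∀ (v : V) (ρ : List V), v :: ρ ∈ nodes → v ∈ G.V0 →
    ∃! w, G.E v w ∧ w :: v :: ρ ∈ nodes
  all_moves : ∀ (v : V) (ρ : List V), v :: ρ ∈ nodes → v ∈ G.V1 →
    ∀ w, G.E v w → w :: v :: ρ ∈ nodes

/-- The finite initial segment `π 0, …, π n` of an infinite sequence of positions
(with the last position `π n` at the head). -/
def initialPath (π : ℕ → V) : ℕ → List V
  | 0 => [π 0]
  | n + 1 => π (n + 1) :: initialPath π n

namespace Strategy

variable {G : BuchiGame V} {u v : V}

/-- The infinite sequence `π` is a play contained in `S` (an infinite branch of the tree `S`). -/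
def ContainsPlay (S : G.Strategy v) (π : ℕ → V) : Prop :=
  ∀ n, initialPath π n ∈ S.nodes

/-- `S` is winning if every play contained in `S` visits `F` infinitely often. -/
def IsWinning (S : G.Strategy v) : Prop :=
  ∀ π : ℕ → V, S.ContainsPlay π → {n : ℕ | π n ∈ G.F}.Infinite

/-- The number of times, in `ℕ ∪ {∞}`, that the edge `a b` occurs in the tree `S`: the number of
nodes `a :: ρ` of `S` whose prolongation by `b` is a node of `S`, too (counted through `ρ`). -/
noncomputable def edgeCount (S : G.Strategy v) (a b : V) : ℕ∞ :=
  {ρ : List V | a :: ρ ∈ S.nodes ∧ b :: a :: ρ ∈ S.nodes}.encard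

/-- `S₁` absorbs `S₂`: `S₁` uses each edge at most as often as `S₂`. -/
def Absorbs (S₁ : G.Strategy u) (S₂ : G.Strategy v) : Prop :=
  ∀ a b, G.E a b → S₁.edgeCount a b ≤ S₂.edgeCount a b

/-- `S₁` strictly absorbs `S₂`. -/
def StrictlyAbsorbs (S₁ : G.Strategy u) (S₂ : G.Strategy v) : Prop :=
  S₁.Absorbs S₂ ∧ ∃ a b, G.E a b ∧ S₁.edgeCount a b < S₂.edgeCount a b

/-- `S` is absorption-dominant from `v`: no strategy from `v` strictly absorbs `S`. -/
def IsAbsorptionDominant (S : G.Strategy v) : Prop :=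
  ¬ ∃ S' : G.Strategy v, S'.StrictlyAbsorbs S

/-- The choice of `S` at `w` is the same at all occurrences of `w` in `S`. -/
def PlaysPositionallyFrom (S : G.Strategy v) (w : V) : Prop :=
  ∀ (ρ ρ' : List V) (a b : V), a :: w :: ρ ∈ S.nodes → b :: w :: ρ' ∈ S.nodes → a = b

/-- `S` is positional. -/
def IsPositional (S : G.Strategy v) : Prop :=
  ∀ w ∈ G.V0, S.PlaysPositionallyFrom w

/-- `S` is persistent: within each single play contained in `S`, the choice at a position of
Player 0 is always the same. -/
def IsPersistent (S : G.Strategy v) : Prop :=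
  ∀ π : ℕ → V, S.ContainsPlay π →
    ∀ i j : ℕ, π i ∈ G.V0 → π i = π j → π (i + 1) = π (j + 1)

end Strategy

end BuchiGame

/-!
A positional strategy `S` uses at most one edge out of each position of Player 0. A strategy that
absorbs `S` can use no edge that `S` does not use, so it makes the same choices and equals `S`;
hence `S` is absorption-dominant (`Strategy.IsPositional.isAbsorptionDominant`).

That an absorption-dominant strategy `S` is persistent rests on two ways to improve a strategy.

* If a node `Q` of `S` properly prolongs a node `P` that ends in the same position, then the subtree
  at `P` may be replaced by the subtree at `Q`. This increases no edge count, and it loses the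
  edges that leave `P`. If `S` is absorption-dominant, these edges must therefore occur infinitely
  often in `S` (`Strategy.IsAbsorptionDominant.edgeCount_eq_top`).
* Let `R` be the set of positions that occur infinitely often in `S`. From each position of `R`
  that belongs to Player 0 some edge occurs infinitely often in `S`, by the pigeonhole principle;
  from the other positions of `R` all edges do. All these edges lead back to `R`. So as soon as `R`
  is reached, Player 0 may play positionally, with edges whose count in `S` is infinite, and no
  edge count increases. If `S` is absorption-dominant, then it used no other edges from these
  positions of Player 0 itself, i.e. it plays positionally from them
  (`Strategy.IsAbsorptionDominant.playsPositionallyFrom`).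

If a play of `S` visits a position of Player 0 twice, then by the first fact this position occurs
infinitely often in `S`, and by the second fact `S` plays positionally from it.

The first inclusion is strict because of a game in which a position of Player 0 is reached along
exactly two paths, and a strategy that leaves it by a different edge each time: a strategy that
uses one of the two edges twice does not absorb it. The second inclusion is strict
because of a game in which Player 0 has to move at most once in each play, but the position where
this happens is reached along infinitely many paths. A strategy that uses each of two edges
infinitely often is persistent, but it is strictly absorbed by the strategy that always takes the first one.
-/

namespace BuchiGame

variable {V : Type*} {G : BuchiGame V} {v : V}

/-! ### Strategies given by choice functions -/

/-- The finite paths from `v` along which Player 0 moves according to `σ`, a function of the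
history of the play (with its last position at the head of the list). -/
inductive Follows (G : BuchiGame V) (v : V) (σ : List V → V) : List V → Prop
  | root : Follows G v σ [v]
  | step {u w : V} {ρ : List V} : Follows G v σ (u :: ρ) → G.E u w →
      (u ∈ G.V0 → w = σ (u :: ρ)) → Follows G v σ (w :: u :: ρ)

namespace Follows

variable {σ : List V → V}

theorem isPath {p : List V} (h : G.Follows v σ p) : G.IsPath v p := by
  induction h with
  | root => exact .root
  | step _ hE _ ih => exact .step ih hE

theorem cons_cons_iff {u w : V} {ρ : List V} :
    G.Follows v σ (w :: u :: ρ) ↔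
      G.Follows v σ (u :: ρ) ∧ G.E u w ∧ (u ∈ G.V0 → w = σ (u :: ρ)) := by
  constructor
  · rintro (_ | ⟨h₁, h₂, h₃⟩)
    exact ⟨h₁, h₂, h₃⟩
  · rintro ⟨h₁, h₂, h₃⟩
    exact .step h₁ h₂ h₃

end Follows

namespace Strategy

/-- The strategy from `v` that moves according to `σ`, provided that `σ` proposes legal moves at the
paths that arise in this way. -/
def ofChoice (G : BuchiGame V) (v : V) (σ : List V → V)
    (hσ : ∀ u ρ, G.Follows v σ (u :: ρ) → u ∈ G.V0 → G.E u (σ (u :: ρ))) : G.Strategy v where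
  nodes := {p | G.Follows v σ p}
  isPath _ hp := hp.isPath
  root_mem := .root
  prefix_closed _ _ _ h := (Follows.cons_cons_iff.1 h).1
  unique_choice u ρ h hu :=
    ⟨σ (u :: ρ), ⟨hσ u ρ h hu, Follows.step h (hσ u ρ h hu) fun _ => rfl⟩,
      fun _ hw => (Follows.cons_cons_iff.1 hw.2).2.2 hu⟩
  all_moves _ _ h hu _ hE := Follows.step h hE fun hu' => absurd hu' hu

theorem cons_mem_ofChoice_iff {σ : List V → V}
    {hσ : ∀ u ρ, G.Follows v σ (u :: ρ) → u ∈ G.V0 → G.E u (σ (u :: ρ))} {u w : V} {ρ : List V} :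
    w :: u :: ρ ∈ (ofChoice G v σ hσ).nodes ↔
      u :: ρ ∈ (ofChoice G v σ hσ).nodes ∧ G.E u w ∧ (u ∈ G.V0 → w = σ (u :: ρ)) :=
  Follows.cons_cons_iff

variable {S T : G.Strategy v}

theorem edge_of_mem {u w : V} {ρ : List V} (h : w :: u :: ρ ∈ S.nodes) : G.E u w := by
  rcases S.isPath _ h with _ | ⟨_, hE⟩
  exact hE

theorem exists_cons_mem {u : V} {ρ : List V} (h : u :: ρ ∈ S.nodes) :
    ∃ w, w :: u :: ρ ∈ S.nodes := by
  by_cases hu : u ∈ G.V0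
  · obtain ⟨w, hw, _⟩ := S.unique_choice u ρ h hu
    exact ⟨w, hw.2⟩
  · obtain ⟨w, hw⟩ := G.exists_move u
    exact ⟨w, S.all_moves u ρ h hu w hw⟩

open Classical in
/-- A position that prolongs the path `p` inside `S`; at a node of `S` that ends in a position of
Player 0 it is the choice of `S`. At lists that are not nodes of `S` the value is arbitrary. -/
noncomputable def next (S : G.Strategy v) (p : List V) : V :=
  if h : ∃ w, w :: p ∈ S.nodes then h.choose else v

theorem next_cons_mem {u : V} {ρ : List V} (h : u :: ρ ∈ S.nodes) :
    S.next (u :: ρ) :: u :: ρ ∈ S.nodes := by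
  rw [next, dif_pos (exists_cons_mem h)]
  exact (exists_cons_mem h).choose_spec

theorem cons_mem {u w : V} {ρ : List V} (h : u :: ρ ∈ S.nodes) (hE : G.E u w)
    (hw : u ∈ G.V0 → w = S.next (u :: ρ)) : w :: u :: ρ ∈ S.nodes := by
  by_cases hu : u ∈ G.V0
  · exact hw hu ▸ next_cons_mem h
  · exact S.all_moves u ρ h hu w hE

/-! ### Edge counts -/

theorem edgeCount_ne_zero {a b : V} {ρ : List V} (h : b :: a :: ρ ∈ S.nodes) :
    S.edgeCount a b ≠ 0 :=
  Set.encard_ne_zero.2 ⟨ρ, S.prefix_closed _ _ _ h, h⟩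

theorem exists_of_edgeCount_ne_zero {a b : V} (h : S.edgeCount a b ≠ 0) :
    ∃ ρ, b :: a :: ρ ∈ S.nodes := by
  obtain ⟨ρ, hρ⟩ := Set.encard_ne_zero.1 h
  exact ⟨ρ, hρ.2⟩

/-- Counting the nodes `a :: ρ` themselves instead of the lists `ρ`. -/
theorem edgeCount_eq_encard (S : G.Strategy v) (a b : V) :
    S.edgeCount a b = {p | p.head? = some a ∧ p ∈ S.nodes ∧ b :: p ∈ S.nodes}.encard := by
  rw [edgeCount, ← (List.cons_injective (a := a)).encard_image]
  congr 1
  ext p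
  cases p <;> simp [eq_comm]
  aesop

theorem edgeCount_eq_top_of_injective {a b : V} {f : ℕ → List V} (hf : f.Injective)
    (h : ∀ n, b :: a :: f n ∈ S.nodes) : S.edgeCount a b = ⊤ :=
  Set.encard_eq_top <| Set.infinite_of_injective_forall_mem hf fun n =>
    ⟨S.prefix_closed _ _ _ (h n), h n⟩

theorem edgeCount_self_eq_top {a : V} {ρ : List V} (h : a :: ρ ∈ S.nodes) (ha : a ∈ G.V1)
    (hE : G.E a a) : S.edgeCount a a = ⊤ := by
  have key : ∀ n, a :: (List.replicate n a ++ ρ) ∈ S.nodes := by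
    intro n
    induction n with
    | zero => exact h
    | succ n ih => exact S.all_moves _ _ ih ha _ hE
  refine edgeCount_eq_top_of_injective (f := fun n => List.replicate n a ++ ρ) ?_
    fun n => key (n + 1)
  intro m n hmn
  simpa using congrArg List.length hmn

/-! ### Positional strategies are absorption-dominant -/

theorem Absorbs.eq_of_isPositional (hS : S.IsPositional) (h : T.Absorbs S) : T = S := by
  have key : ∀ p, G.IsPath v p → (p ∈ T.nodes ↔ p ∈ S.nodes) := by
    intro p hp
    induction hp with
    | root => exact iff_of_true T.root_mem S.root_mem
    | @step u w ρ _ hE ih =>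
      by_cases hu : u ∈ G.V0
      · -- Both strategies make the same choice at the common node `u :: ρ`.
        have main : ∀ a b, a :: u :: ρ ∈ T.nodes → b :: u :: ρ ∈ S.nodes → a = b := by
          intro a b ha hb
          have hne : S.edgeCount u a ≠ 0 := fun h0 =>
            edgeCount_ne_zero ha (nonpos_iff_eq_zero.1 (h0 ▸ h u a (edge_of_mem ha)))
          obtain ⟨ρ', hρ'⟩ := exists_of_edgeCount_ne_zero hne
          exact hS u hu _ _ _ _ hρ' hb
        constructor
        · intro hw
          obtain ⟨b, hb⟩ := exists_cons_mem (ih.1 (T.prefix_closed _ _ _ hw))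
          exact main _ _ hw hb ▸ hb
        · intro hw
          obtain ⟨a, ha⟩ := exists_cons_mem (ih.2 (S.prefix_closed _ _ _ hw))
          exact main _ _ ha hw ▸ ha
      · exact ⟨fun hw => S.all_moves _ _ (ih.1 (T.prefix_closed _ _ _ hw)) hu _ hE,
          fun hw => T.all_moves _ _ (ih.2 (S.prefix_closed _ _ _ hw)) hu _ hE⟩
  ext p
  exact ⟨fun hp => (key p (T.isPath p hp)).1 hp, fun hp => (key p (S.isPath p hp)).2 hp⟩

theorem IsPositional.isAbsorptionDominant (hS : S.IsPositional) : S.IsAbsorptionDominant := by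
  rintro ⟨T, hT, a, b, _, hlt⟩
  rw [hT.eq_of_isPositional hS] at hlt
  exact lt_irrefl _ hlt

/-! ### Replacing a subtree by one further down -/

open Classical in
/-- Replace the initial segment `P` of the path `p` by `Q`; paths that do not begin with `P`
remain unchanged. (Initial segments of paths are suffixes of lists.) -/
noncomputable def replaceInit (P Q p : List V) : List V :=
  if P <:+ p then p.take (p.length - P.length) ++ Q else p

theorem replaceInit_append (P Q τ : List V) : replaceInit P Q (τ ++ P) = τ ++ Q := by
  simp [replaceInit]

theorem replaceInit_of_not_suffix {P p : List V} (Q : List V) (h : ¬ P <:+ p) :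
    replaceInit P Q p = p :=
  if_neg h

theorem head?_replaceInit {P Q : List V} (hhead : P.head? = Q.head?) (p : List V) :
    (replaceInit P Q p).head? = p.head? := by
  by_cases h : P <:+ p
  · obtain ⟨τ, rfl⟩ := h
    simp [replaceInit_append, hhead]
  · rw [replaceInit_of_not_suffix Q h]

theorem exists_replaceInit_cons {P Q : List V} (hhead : P.head? = Q.head?) (x : V) (ρ : List V) :
    ∃ ρ', replaceInit P Q (x :: ρ) = x :: ρ' := by
  have := head?_replaceInit hhead (x :: ρ)
  cases h : replaceInit P Q (x :: ρ) <;> simp_all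

theorem replaceInit_injective {P Q : List V} (hPQ : P <:+ Q) :
    Function.Injective (replaceInit P Q) := by
  intro p q hpq
  by_cases hp : P <:+ p <;> by_cases hq : P <:+ q
  · obtain ⟨τ, rfl⟩ := hp
    obtain ⟨τ', rfl⟩ := hq
    simpa [replaceInit_append] using hpq
  · obtain ⟨τ, rfl⟩ := hp
    rw [replaceInit_append, replaceInit_of_not_suffix Q hq] at hpq
    exact absurd (hpq ▸ hPQ.trans (List.suffix_append τ Q)) hq
  · obtain ⟨τ, rfl⟩ := hq
    rw [replaceInit_append, replaceInit_of_not_suffix Q hp] at hpq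
    exact absurd (hpq ▸ hPQ.trans (List.suffix_append τ Q)) hp
  · rwa [replaceInit_of_not_suffix Q hp, replaceInit_of_not_suffix Q hq] at hpq

theorem replaceInit_ne {P Q : List V} (hPQ : P <:+ Q) (hne : P ≠ Q) (p : List V) :
    replaceInit P Q p ≠ P := by
  by_cases hp : P <:+ p
  · obtain ⟨τ, rfl⟩ := hp
    rw [replaceInit_append]
    intro h
    exact hne (hPQ.eq_of_length_le (h ▸ (List.suffix_append τ Q).length_le))
  · rw [replaceInit_of_not_suffix Q hp]
    rintro rfl
    exact hp List.suffix_rfl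

/-- The strategy that plays after `P` as `S` plays after `Q`, and like `S` elsewhere, is given by
the choice function `S.next ∘ replaceInit P Q`; its nodes are mapped into `S` by `replaceInit P Q`. -/
theorem replaceInit_mem {P Q : List V} (hQ : Q ∈ S.nodes) (hhead : P.head? = Q.head?)
    {p : List V} (hp : G.Follows v (fun q => S.next (replaceInit P Q q)) p) :
    replaceInit P Q p ∈ S.nodes := by
  induction hp with
  | root =>
    by_cases h : P <:+ [v]
    · obtain ⟨τ, hτ⟩ := h
      rw [← hτ, replaceInit_append]
      rcases τ with _ | ⟨x, τ⟩
      · exact hQ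
      · -- Here `P` would be empty, hence `Q`, which is a node, would be empty, too.
        have hP : P = [] := by simp_all
        have hQ' : Q = [] := by simpa [hP] using hhead.symm
        exact absurd (S.isPath _ (hQ' ▸ hQ)) (by rintro ⟨⟩)
    · rw [replaceInit_of_not_suffix Q h]
      exact S.root_mem
  | @step u w ρ _ hE hw ih =>
    obtain ⟨ρ', hρ'⟩ := exists_replaceInit_cons hhead u ρ
    have hmem : w :: replaceInit P Q (u :: ρ) ∈ S.nodes := by
      rw [hρ'] at ih hw ⊢
      exact cons_mem ih hE hw
    by_cases h : P <:+ u :: ρ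
    · obtain ⟨τ, hτ⟩ := h
      rw [← hτ, replaceInit_append] at hmem
      rw [← hτ, ← List.cons_append, replaceInit_append]
      exact hmem
    · rw [replaceInit_of_not_suffix Q h] at hmem
      by_cases h' : P <:+ w :: u :: ρ
      · rcases List.suffix_cons_iff.1 h' with rfl | h'
        · exact (replaceInit_append (w :: u :: ρ) Q []).symm ▸ hQ
        · exact absurd h' h
      · rwa [replaceInit_of_not_suffix Q h']

/-- An edge that leaves a node `P` of an absorption-dominant strategy occurs infinitely often in
the strategy if a proper prolongation of `P` ends in the same position as `P`. -/
theorem IsAbsorptionDominant.edgeCount_eq_top (hS : S.IsAbsorptionDominant) {P Q : List V}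
    {u a : V} (hPu : P.head? = some u) (hQu : Q.head? = some u) (hPQ : P <:+ Q) (hne : P ≠ Q)
    (hQ : Q ∈ S.nodes) (ha : a :: P ∈ S.nodes) : S.edgeCount u a = ⊤ := by
  have hhead : P.head? = Q.head? := hPu.trans hQu.symm
  let T : G.Strategy v := ofChoice G v (fun q => S.next (replaceInit P Q q)) (by
    intro x ρ hx _
    have := replaceInit_mem hQ hhead hx
    obtain ⟨ρ', hρ'⟩ := exists_replaceInit_cons hhead x ρ
    rw [hρ'] at this ⊢
    exact edge_of_mem (next_cons_mem this))
  -- `replaceInit P Q` embeds the occurrences of an edge in `T` into those in `S` other than `P`.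
  have hmaps : ∀ x y, Set.MapsTo (replaceInit P Q)
      {p | p.head? = some x ∧ p ∈ T.nodes ∧ y :: p ∈ T.nodes}
      ({p | p.head? = some x ∧ p ∈ S.nodes ∧ y :: p ∈ S.nodes} \ {P}) := by
    rintro x y (_ | ⟨z, ρ⟩) ⟨hz, hp, hy⟩
    · simp at hz
    have hmem := replaceInit_mem hQ hhead hp
    refine ⟨⟨(head?_replaceInit hhead _).trans hz, hmem, ?_⟩, replaceInit_ne hPQ hne _⟩
    obtain ⟨-, hE, hw⟩ := Strategy.cons_mem_ofChoice_iff.1 hy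
    obtain ⟨ρ', hρ'⟩ := exists_replaceInit_cons hhead z ρ
    rw [hρ'] at hmem hw ⊢
    exact cons_mem hmem hE hw
  have hle : ∀ x y, T.edgeCount x y ≤
      ({p | p.head? = some x ∧ p ∈ S.nodes ∧ y :: p ∈ S.nodes} \ {P}).encard := by
    intro x y
    rw [edgeCount_eq_encard]
    exact Set.encard_le_encard_of_injOn (hmaps x y) (replaceInit_injective hPQ).injOn
  obtain ⟨ρ, rfl⟩ : ∃ ρ, P = u :: ρ := by
    cases P with
    | nil => simp at hPu
    | cons x ρ => exact ⟨ρ, by simpa using hPu⟩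
  by_contra htop
  refine hS ⟨T, fun x y _ => ?_, u, a, edge_of_mem ha, ?_⟩
  · rw [edgeCount_eq_encard S]
    exact (hle x y).trans (Set.encard_le_encard Set.sdiff_subset)
  · refine (hle u a).trans_lt ?_
    rw [edgeCount_eq_encard] at htop ⊢
    have hfin := Set.encard_ne_top_iff.1 htop
    refine (hfin.subset Set.sdiff_subset).encard_lt_encard ?_
    exact Set.sdiff_singleton_ssubset.2 ⟨hPu, S.prefix_closed _ _ _ ha, ha⟩

/-! ### Positions that occur infinitely often -/

/-- The positions in which infinitely many nodes of the tree `S` end. -/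
def infinitePositions (S : G.Strategy v) : Set V :=
  {x | {ρ | x :: ρ ∈ S.nodes}.Infinite}

theorem edgeCount_eq_top_of_mem_V1 {x y : V} (hx : x ∈ S.infinitePositions) (hx1 : x ∈ G.V1)
    (hE : G.E x y) : S.edgeCount x y = ⊤ :=
  Set.encard_eq_top <| hx.mono fun ρ hρ => ⟨hρ, S.all_moves x ρ hρ hx1 y hE⟩

theorem exists_edgeCount_eq_top [Finite V] {x : V} (hx : x ∈ S.infinitePositions) :
    ∃ y, S.edgeCount x y = ⊤ := by
  by_contra! h
  refine hx ((Set.finite_iUnion fun y => Set.encard_ne_top_iff.1 (h y)).subset ?_)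
  intro ρ hρ
  obtain ⟨y, hy⟩ := exists_cons_mem hρ
  exact Set.mem_iUnion.2 ⟨y, hρ, hy⟩

theorem source_mem_infinitePositions {x y : V} (h : S.edgeCount x y = ⊤) :
    x ∈ S.infinitePositions :=
  (Set.encard_eq_top_iff.1 h).mono fun _ hρ => hρ.1

theorem target_mem_infinitePositions {x y : V} (h : S.edgeCount x y = ⊤) :
    y ∈ S.infinitePositions :=
  Set.infinite_of_injOn_mapsTo (f := List.cons x) List.cons_injective.injOn
    (fun _ hρ => hρ.2) (Set.encard_eq_top_iff.1 h)

/-- An absorption-dominant strategy plays positionally from the positions that occur infinitely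
often in it. -/
theorem IsAbsorptionDominant.playsPositionallyFrom [Finite V] (hS : S.IsAbsorptionDominant)
    {w : V} (hw : w ∈ S.infinitePositions) (hw0 : w ∈ G.V0) : S.PlaysPositionallyFrom w := by
  classical
  have : Nonempty V := ⟨v⟩
  choose! c hc using fun x (hx : x ∈ S.infinitePositions) => exists_edgeCount_eq_top hx
  let σ : List V → V
    | [] => v
    | x :: ρ => if x ∈ S.infinitePositions then c x else S.next (x :: ρ)
  have hσ_inf : ∀ {x} ρ, x ∈ S.infinitePositions → σ (x :: ρ) = c x := fun _ hx => if_pos hx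
  have hσ_fin : ∀ {x} ρ, x ∉ S.infinitePositions → σ (x :: ρ) = S.next (x :: ρ) :=
    fun _ hx => if_neg hx
  have hstep : ∀ {x y ρ}, x ∈ S.infinitePositions → G.E x y → (x ∈ G.V0 → y = σ (x :: ρ)) →
      S.edgeCount x y = ⊤ := by
    intro x y ρ hx hE hy
    by_cases hx0 : x ∈ G.V0
    · rw [hy hx0, hσ_inf ρ hx]
      exact hc x hx
    · exact edgeCount_eq_top_of_mem_V1 hx hx0 hE
  -- The set of infinitely frequent positions is never left again, and before it is reached,
  -- the modified strategy agrees with `S`.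
  have hinv : ∀ {p}, G.Follows v σ p →
      ∃ x ρ, p = x :: ρ ∧ (x ∈ S.infinitePositions ∨ x :: ρ ∈ S.nodes) := by
    intro p hp
    induction hp with
    | root => exact ⟨v, [], rfl, .inr S.root_mem⟩
    | @step x y ρ _ hE hy ih =>
      obtain ⟨_, _, ⟨⟩, hx⟩ := ih
      refine ⟨y, x :: ρ, rfl, ?_⟩
      by_cases hxi : x ∈ S.infinitePositions
      · exact .inl (target_mem_infinitePositions (hstep hxi hE hy))
      · rw [hσ_fin ρ hxi] at hy
        exact .inr (cons_mem (hx.resolve_left hxi) hE hy)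
  have hnode : ∀ {x ρ}, G.Follows v σ (x :: ρ) → x ∉ S.infinitePositions → x :: ρ ∈ S.nodes := by
    intro x ρ h hx
    obtain ⟨_, _, ⟨⟩, h'⟩ := hinv h
    exact h'.resolve_left hx
  let T : G.Strategy v := ofChoice G v σ (by
    intro x ρ h _
    by_cases hx : x ∈ S.infinitePositions
    · rw [hσ_inf ρ hx]
      obtain ⟨_, h'⟩ := exists_of_edgeCount_ne_zero (S := S) (hc x hx ▸ ENat.top_ne_zero)
      exact edge_of_mem h'
    · rw [hσ_fin ρ hx]
      exact edge_of_mem (next_cons_mem (hnode h hx)))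
  have hT : T.Absorbs S := by
    intro x y hxy
    by_cases hx : x ∈ S.infinitePositions
    · by_cases h : T.edgeCount x y = 0
      · simp [h]
      · obtain ⟨ρ, hρ⟩ := exists_of_edgeCount_ne_zero h
        rw [hstep hx hxy (Strategy.cons_mem_ofChoice_iff.1 hρ).2.2]
        exact le_top
    · refine Set.encard_le_encard ?_
      rintro ρ ⟨h₁, h₂⟩
      obtain ⟨-, hE, hy⟩ := Strategy.cons_mem_ofChoice_iff.1 h₂
      rw [hσ_fin ρ hx] at hy
      exact ⟨hnode h₁ hx, cons_mem (hnode h₁ hx) hE hy⟩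
  -- An edge from `w` other than the one to `c w` would disappear altogether.
  have hcw : ∀ ρ a, a :: w :: ρ ∈ S.nodes → a = c w := by
    intro ρ a ha
    by_contra hne
    refine hS ⟨T, hT, w, a, edge_of_mem ha, ?_⟩
    have h0 : T.edgeCount w a = 0 := by
      by_contra h
      obtain ⟨ρ', hρ'⟩ := exists_of_edgeCount_ne_zero h
      exact hne (((Strategy.cons_mem_ofChoice_iff.1 hρ').2.2 hw0).trans (hσ_inf ρ' hw))
    rw [h0]
    exact pos_iff_ne_zero.2 (edgeCount_ne_zero ha)
  intro ρ ρ' a b ha hb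
  rw [hcw ρ a ha, hcw ρ' b hb]

/-! ### Absorption-dominant strategies are persistent -/

theorem initialPath_eq_cons (π : ℕ → V) (n : ℕ) : ∃ ρ, initialPath π n = π n :: ρ := by
  cases n <;> exact ⟨_, rfl⟩

theorem head?_initialPath (π : ℕ → V) (n : ℕ) : (initialPath π n).head? = some (π n) := by
  cases n <;> rfl

theorem length_initialPath (π : ℕ → V) (n : ℕ) : (initialPath π n).length = n + 1 := by
  induction n with
  | zero => rfl
  | succ n ih => simp [initialPath, ih]

theorem initialPath_suffix (π : ℕ → V) {m n : ℕ} (h : m ≤ n) :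
    initialPath π m <:+ initialPath π n := by
  induction n, h using Nat.le_induction with
  | base => exact List.suffix_rfl
  | succ n _ ih => exact ih.trans (List.suffix_cons _ _)

theorem IsAbsorptionDominant.isPersistent [Finite V] (hS : S.IsAbsorptionDominant) :
    S.IsPersistent := by
  intro π hπ
  have key : ∀ i j, i < j → π i ∈ G.V0 → π i = π j → π (i + 1) = π (j + 1) := by
    intro i j hij hi hw
    have htop : S.edgeCount (π i) (π (i + 1)) = ⊤ := by
      refine hS.edgeCount_eq_top (head?_initialPath π i) (hw ▸ head?_initialPath π j)
        (initialPath_suffix π hij.le) ?_ (hπ j) (hπ (i + 1))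
      intro h
      have := congrArg List.length h
      simp only [length_initialPath] at this
      omega
    obtain ⟨ρ, hρ⟩ := initialPath_eq_cons π i
    obtain ⟨ρ', hρ'⟩ := initialPath_eq_cons π j
    refine hS.playsPositionallyFrom (source_mem_infinitePositions htop) hi ρ ρ' _ _ ?_ ?_
    · rw [← hρ]
      exact hπ (i + 1)
    · rw [hw, ← hρ']
      exact hπ (j + 1)
  intro i j hi hw
  rcases lt_trichotomy i j with h | rfl | h
  · exact key i j h hi hw
  · rfl
  · exact (key j i h (hw ▸ hi) hw.symm).symm

theorem ContainsPlay.edge {π : ℕ → V} (hπ : S.ContainsPlay π) (n : ℕ) :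
    G.E (π n) (π (n + 1)) := by
  obtain ⟨ρ, hρ⟩ := initialPath_eq_cons π n
  have h := hπ (n + 1)
  rw [initialPath, hρ] at h
  exact edge_of_mem h

end Strategy

/-! ### An absorption-dominant winning strategy that is not positional -/

/-- The moves of `twoPathGame`. -/
abbrev twoPathMoves : List (Fin 5 × Fin 5) :=
  [(0, 1), (0, 2), (1, 2), (2, 3), (2, 4), (3, 3), (4, 4)]

/-- Position `2`, the only one of Player 0, is reached from `0` along exactly two paths, directly
and through `1`. There Player 0 chooses between the absorbing target positions `3` and `4`. -/
abbrev twoPathGame : BuchiGame (Fin 5) where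
  V0 := {2}
  E i j := (i, j) ∈ twoPathMoves
  F := {3, 4}
  exists_move := by decide

namespace twoPathGame

/-- The strategy that moves from `2` to `3` if `2` is reached directly, and to `4` otherwise. -/
def splitStrategy : twoPathGame.Strategy 0 :=
  .ofChoice _ _ (fun p => if p = [2, 0] then 3 else 4) (by
    rintro u ρ - rfl
    dsimp only
    split_ifs <;> decide)

theorem isWinning (S : twoPathGame.Strategy 0) : S.IsWinning := by
  intro π hπ
  have hE : ∀ i j : Fin 5, (i, j) ∈ twoPathMoves → i < j ∨ (i = j ∧ 3 ≤ i) := by decide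
  have hge : ∀ n, min n 3 ≤ (π n : ℕ) := by
    intro n
    induction n with
    | zero => simp
    | succ n ih =>
      have := hE _ _ (hπ.edge n)
      omega
  refine Set.infinite_of_forall_exists_gt fun n => ⟨n + 3, ?_, by omega⟩
  have h := hge (n + 3)
  have : ∀ i : Fin 5, 3 ≤ (i : ℕ) → i = 3 ∨ i = 4 := by decide
  exact this _ (by omega)

theorem isPath_zero {ρ : List (Fin 5)} (h : twoPathGame.IsPath 0 (0 :: ρ)) : ρ = [] := by
  rcases h with _ | ⟨_, hE⟩
  · rfl
  · have hE' : ∀ u : Fin 5, (u, 0) ∉ twoPathMoves := by decide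
    exact absurd hE (hE' _)

theorem isPath_one {ρ : List (Fin 5)} (h : twoPathGame.IsPath 0 (1 :: ρ)) : ρ = [0] := by
  rcases h with _ | ⟨h', hE⟩
  rename_i u ρ
  have hE' : ∀ u : Fin 5, (u, 1) ∈ twoPathMoves → u = 0 := by decide
  obtain rfl := hE' u hE
  rw [isPath_zero h']

theorem isPath_two {ρ : List (Fin 5)} (h : twoPathGame.IsPath 0 (2 :: ρ)) :
    ρ = [0] ∨ ρ = [1, 0] := by
  rcases h with _ | ⟨h', hE⟩
  rename_i u ρ
  have hE' : ∀ u : Fin 5, (u, 2) ∈ twoPathMoves → u = 0 ∨ u = 1 := by decide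
  obtain rfl | rfl := hE' u hE
  · exact .inl (by rw [isPath_zero h'])
  · exact .inr (by rw [isPath_one h'])

section

variable (S : twoPathGame.Strategy 0)

theorem one_mem : [1, 0] ∈ S.nodes :=
  S.all_moves 0 [] S.root_mem (by simp [V1]) 1 (by decide)

theorem two_mem : [2, 0] ∈ S.nodes :=
  S.all_moves 0 [] S.root_mem (by simp [V1]) 2 (by decide)

theorem two_one_mem : [2, 1, 0] ∈ S.nodes :=
  S.all_moves 1 [0] (one_mem S) (by simp [V1]) 2 (by decide)

/-- At each node that ends in `2`, a strategy moves to `3` or to `4`. -/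
theorem three_or_four {ρ : List (Fin 5)} (h : 2 :: ρ ∈ S.nodes) :
    3 :: 2 :: ρ ∈ S.nodes ∨ 4 :: 2 :: ρ ∈ S.nodes := by
  obtain ⟨a, ha⟩ := Strategy.exists_cons_mem h
  have hE : ∀ i : Fin 5, (2, i) ∈ twoPathMoves → i = 3 ∨ i = 4 := by decide
  rcases hE a (Strategy.edge_of_mem ha) with rfl | rfl
  exacts [.inl ha, .inr ha]

theorem one_lt_edgeCount {a : Fin 5} (h₁ : [a, 2, 0] ∈ S.nodes) (h₂ : [a, 2, 1, 0] ∈ S.nodes) :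
    1 < S.edgeCount 2 a :=
  Set.one_lt_encard_iff.2 ⟨[0], [1, 0], ⟨two_mem S, h₁⟩, ⟨two_one_mem S, h₂⟩, by decide⟩

end

theorem three_mem_splitStrategy : [3, 2, 0] ∈ splitStrategy.nodes :=
  Strategy.cons_mem_ofChoice_iff.2 ⟨two_mem splitStrategy, by decide, fun _ => rfl⟩

theorem four_mem_splitStrategy : [4, 2, 1, 0] ∈ splitStrategy.nodes :=
  Strategy.cons_mem_ofChoice_iff.2 ⟨two_one_mem splitStrategy, by decide, fun _ => rfl⟩

theorem edgeCount_splitStrategy_le {a : Fin 5} : splitStrategy.edgeCount 2 a ≤ 1 := by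
  refine Set.encard_le_one_iff.2 ?_
  rintro ρ ρ' ⟨h₁, h₂⟩ ⟨h₁', h₂'⟩
  have e := (Strategy.cons_mem_ofChoice_iff.1 h₂).2.2 rfl
  have e' := (Strategy.cons_mem_ofChoice_iff.1 h₂').2.2 rfl
  rcases isPath_two (splitStrategy.isPath _ h₁) with rfl | rfl <;>
    rcases isPath_two (splitStrategy.isPath _ h₁') with rfl | rfl <;> simp_all

theorem splitStrategy_isAbsorptionDominant : splitStrategy.IsAbsorptionDominant := by
  rintro ⟨T, hT, a, b, hab, hlt⟩
  have h3 : T.edgeCount 2 3 ≤ 1 := (hT 2 3 (by decide)).trans edgeCount_splitStrategy_le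
  have h4 : T.edgeCount 2 4 ≤ 1 := (hT 2 4 (by decide)).trans edgeCount_splitStrategy_le
  -- `T` uses both edges from `2`, in one order or the other.
  obtain ⟨⟨ρ₃, h3'⟩, ⟨ρ₄, h4'⟩⟩ : (∃ ρ, 3 :: 2 :: ρ ∈ T.nodes) ∧ ∃ ρ, 4 :: 2 :: ρ ∈ T.nodes := by
    rcases three_or_four T (two_mem T) with h | h <;>
      rcases three_or_four T (two_one_mem T) with h' | h'
    · exact absurd h3 (one_lt_edgeCount T h h').not_ge
    · exact ⟨⟨_, h⟩, ⟨_, h'⟩⟩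
    · exact ⟨⟨_, h'⟩, ⟨_, h⟩⟩
    · exact absurd h4 (one_lt_edgeCount T h h').not_ge
  refine hlt.not_ge ?_
  simp only [twoPathMoves, List.mem_cons, Prod.mk.injEq, List.not_mem_nil, or_false] at hab
  rcases hab with ⟨rfl, rfl⟩ | ⟨rfl, rfl⟩ | ⟨rfl, rfl⟩ | ⟨rfl, rfl⟩ | ⟨rfl, rfl⟩ | ⟨rfl, rfl⟩ |
    ⟨rfl, rfl⟩
  · refine Set.encard_le_encard ?_
    rintro ρ ⟨h, -⟩
    obtain rfl := isPath_zero (splitStrategy.isPath _ h)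
    exact ⟨T.root_mem, one_mem T⟩
  · refine Set.encard_le_encard ?_
    rintro ρ ⟨h, -⟩
    obtain rfl := isPath_zero (splitStrategy.isPath _ h)
    exact ⟨T.root_mem, two_mem T⟩
  · refine Set.encard_le_encard ?_
    rintro ρ ⟨h, -⟩
    obtain rfl := isPath_one (splitStrategy.isPath _ h)
    exact ⟨one_mem T, two_one_mem T⟩
  · exact edgeCount_splitStrategy_le.trans
      (Order.one_le_iff_ne_zero.2 (Strategy.edgeCount_ne_zero h3'))
  · exact edgeCount_splitStrategy_le.trans
      (Order.one_le_iff_ne_zero.2 (Strategy.edgeCount_ne_zero h4'))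
  · rw [Strategy.edgeCount_self_eq_top h3' (by simp [V1]) (by decide)]
    exact le_top
  · rw [Strategy.edgeCount_self_eq_top h4' (by simp [V1]) (by decide)]
    exact le_top

theorem splitStrategy_not_isPositional : ¬ splitStrategy.IsPositional := by
  intro h
  exact absurd (h 2 rfl _ _ _ _ three_mem_splitStrategy four_mem_splitStrategy) (by decide)

end twoPathGame

/-! ### A persistent winning strategy that is not absorption-dominant -/

/-- The moves of `delayGame`. -/
abbrev delayMoves : List (Fin 4 × Fin 4) :=
  [(0, 0), (0, 1), (1, 2), (1, 3), (2, 2), (3, 3)]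

/-- Player 1 may stay in the target position `0` for some time before moving to `1`, the only
position of Player 0, who chooses there between the absorbing target positions `2` and `3`. -/
abbrev delayGame : BuchiGame (Fin 4) where
  V0 := {1}
  E i j := (i, j) ∈ delayMoves
  F := {1}ᶜ
  exists_move := by decide

namespace delayGame

/-- The strategy that moves from `1` to `2` or to `3`, depending on the parity of the time at which
`1` is reached. -/
def parityStrategy : delayGame.Strategy 0 :=
  .ofChoice _ _ (fun p => if Even p.length then 2 else 3) (by
    rintro u ρ - rfl
    dsimp only
    split_ifs <;> decide)

/-- The strategy that always moves from `1` to `2`. -/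
def constStrategy : delayGame.Strategy 0 :=
  .ofChoice _ _ (fun _ => 2) (by
    rintro u ρ - rfl
    decide)

theorem isWinning (S : delayGame.Strategy 0) : S.IsWinning := by
  intro π hπ
  refine Set.infinite_of_forall_exists_gt fun n => ?_
  by_cases h : π (n + 1) = 1
  · -- Position `1` has no loop.
    refine ⟨n + 2, fun h' => ?_, by omega⟩
    have hE := hπ.edge (n + 1)
    rw [h, Set.mem_singleton_iff.1 h'] at hE
    exact absurd hE (by decide)
  · exact ⟨n + 1, h, by omega⟩

/-- Each play visits position `1` at most once. -/
theorem isPersistent (S : delayGame.Strategy 0) : S.IsPersistent := by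
  intro π hπ i j hi hij
  have hmono : Monotone π := monotone_nat_of_le_succ fun n => by
    have hE : ∀ i j : Fin 4, (i, j) ∈ delayMoves → i ≤ j := by decide
    exact hE _ _ (hπ.edge n)
  have hlt : ∀ n, π n = 1 → 1 < π (n + 1) := by
    intro n hn
    have hE : ∀ i : Fin 4, (1, i) ∈ delayMoves → 1 < i := by decide
    exact hE _ (hn ▸ hπ.edge n)
  have hi : π i = 1 := hi
  have hj : π j = 1 := hij ▸ hi
  rcases lt_trichotomy i j with h | rfl | h
  · exact absurd (hj ▸ (hlt i hi).trans_le (hmono (Nat.succ_le_of_lt h))) (lt_irrefl _)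
  · rfl
  · exact absurd (hi ▸ (hlt j hj).trans_le (hmono (Nat.succ_le_of_lt h))) (lt_irrefl _)

theorem replicate_mem (S : delayGame.Strategy 0) (n : ℕ) :
    0 :: List.replicate n 0 ∈ S.nodes := by
  induction n with
  | zero => exact S.root_mem
  | succ n ih => exact S.all_moves _ _ ih (by simp [V1]) _ (by decide)

theorem one_replicate_mem (S : delayGame.Strategy 0) (n : ℕ) :
    1 :: 0 :: List.replicate n 0 ∈ S.nodes :=
  S.all_moves _ _ (replicate_mem S n) (by simp [V1]) _ (by decide)

theorem two_replicate_mem (n : ℕ) :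
    2 :: 1 :: 0 :: List.replicate (2 * n) 0 ∈ parityStrategy.nodes :=
  Strategy.cons_mem_ofChoice_iff.2 ⟨one_replicate_mem parityStrategy _, by decide, fun _ => by
    simp [Nat.even_add_one]⟩

theorem three_replicate_mem (n : ℕ) :
    3 :: 1 :: 0 :: List.replicate (2 * n + 1) 0 ∈ parityStrategy.nodes :=
  Strategy.cons_mem_ofChoice_iff.2 ⟨one_replicate_mem parityStrategy _, by decide, fun _ => by
    simp [Nat.even_add_one]⟩

theorem edgeCount_parityStrategy {a b : Fin 4} (hab : (a, b) ∈ delayMoves) :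
    parityStrategy.edgeCount a b = ⊤ := by
  simp only [delayMoves, List.mem_cons, Prod.mk.injEq, List.not_mem_nil, or_false] at hab
  rcases hab with ⟨rfl, rfl⟩ | ⟨rfl, rfl⟩ | ⟨rfl, rfl⟩ | ⟨rfl, rfl⟩ | ⟨rfl, rfl⟩ | ⟨rfl, rfl⟩
  · exact Strategy.edgeCount_self_eq_top parityStrategy.root_mem (by simp [V1]) (by decide)
  · exact Strategy.edgeCount_eq_top_of_injective (List.replicate_left_injective 0)
      (one_replicate_mem _)
  · refine Strategy.edgeCount_eq_top_of_injective (fun m n h => ?_) two_replicate_mem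
    simpa using congrArg List.length h
  · refine Strategy.edgeCount_eq_top_of_injective (fun m n h => ?_) three_replicate_mem
    simpa using congrArg List.length h
  · exact Strategy.edgeCount_self_eq_top (two_replicate_mem 0) (by simp [V1]) (by decide)
  · exact Strategy.edgeCount_self_eq_top (three_replicate_mem 0) (by simp [V1]) (by decide)

theorem parityStrategy_not_isAbsorptionDominant : ¬ parityStrategy.IsAbsorptionDominant := by
  refine fun h => h ⟨constStrategy, fun a b hab => ?_, 1, 3, by decide, ?_⟩
  · rw [edgeCount_parityStrategy hab]
    exact le_top
  · have h0 : constStrategy.edgeCount 1 3 = 0 := by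
      by_contra hne
      obtain ⟨ρ, hρ⟩ := Strategy.exists_of_edgeCount_ne_zero hne
      exact absurd ((Strategy.cons_mem_ofChoice_iff.1 hρ).2.2 rfl) (by decide)
    rw [h0, edgeCount_parityStrategy (by decide)]
    exact ENat.top_pos

end delayGame

end BuchiGame

theorem mainTheorem2 :
    -- every absorption-dominant winning strategy is persistent
    (∀ (V : Type*) [Finite V] (G : BuchiGame V) (v : V) (S : G.Strategy v),
      S.IsWinning → S.IsAbsorptionDominant → S.IsPersistent) ∧
    -- every positional winning strategy is absorption-dominant
    (∀ (V : Type*) [Finite V] (G : BuchiGame V) (v : V) (S : G.Strategy v),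
      S.IsWinning → S.IsPositional → S.IsAbsorptionDominant) ∧
    -- both inclusions are strict
    (∃ (V : Type) (_ : Finite V) (G : BuchiGame V) (v : V) (S : G.Strategy v),
      S.IsWinning ∧ S.IsAbsorptionDominant ∧ ¬ S.IsPositional) ∧
    (∃ (V : Type) (_ : Finite V) (G : BuchiGame V) (v : V) (S : G.Strategy v),
      S.IsWinning ∧ S.IsPersistent ∧ ¬ S.IsAbsorptionDominant) :=
  ⟨fun _ _ _ _ _ _ h => h.isPersistent, fun _ _ _ _ _ _ h => h.isAbsorptionDominant,
    ⟨Fin 5, inferInstance, BuchiGame.twoPathGame, 0, BuchiGame.twoPathGame.splitStrategy,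
      BuchiGame.twoPathGame.isWinning _,
      BuchiGame.twoPathGame.splitStrategy_isAbsorptionDominant,
      BuchiGame.twoPathGame.splitStrategy_not_isPositional⟩,
    ⟨Fin 4, inferInstance, BuchiGame.delayGame, 0, BuchiGame.delayGame.parityStrategy,
      BuchiGame.delayGame.isWinning _, BuchiGame.delayGame.isPersistent _,
      BuchiGame.delayGame.parityStrategy_not_isAbsorptionDominant⟩⟩
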